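/- Consider the following two-player game $BS_2(\mathcal{P}_4 : p,q)$. It starts with two spots in the plane, having $p$ and $q$ open tips respectively and no curves. A move consists of joining two open tips by a curve that does not cross anything drawn so far, and then drawing a crossbar on that curve, which creates two new open tips, one on each side of the curve. The graph whose vertices are the spots and the crossings of curves with their crossbars, and whose edges are the pieces of curves joining two such vertices, must at all times be a (simple) planar graph of girth at least $4$. The play ends when no valid move exists. Theorem. Let $p, q \ge 3$ be integers with $p \le q \le 2p$. Then there is a play of $BS_2(\mathcal{P}_4 : p,q)$ that ends after exactly $p+q$ moves, and there is a play of $BS_2(\mathcal{P}_4 : p,q)$ that ends after exactly $6$ moves. -/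

import Mathlib

/-!
# Generalized Brussels sprout for planar graphs of girth at least `g`

A position is a drawing on the plane (equivalently, on the sphere) without crossings, recorded up to
homeomorphism by the usual combinatorial data: the rotation of the arms around every vertex, the
pairing of arms into edges, and the face of the drawing in which every arm lies.
-/

namespace BrusselsSprout

/-- The arms (half-edges and open tips): arm `j` of spot `i` is `Sum.inl ⟨i, j⟩`, and
`Sum.inr (k, s)` with `s = 0, 1, 2, 3` are the four arms, in rotational order, at the crossing of
the `k`-th curve (counted from `0`) with its crossbar. -/
abbrev Arm {n : ℕ} (t : Fin n → ℕ) : Type := (Σ i : Fin n, Fin (t i)) ⊕ (ℕ × Fin 4)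

/-- The vertices: the `n` initial spots, and one vertex for every crossbar. -/
abbrev Vertex (n : ℕ) : Type := Fin n ⊕ ℕ

/-- The vertex at which an arm is attached. -/
def vert {n : ℕ} {t : Fin n → ℕ} : Arm t → Vertex n := Sum.map Sigma.fst Prod.fst

/-- The next arm in the rotation around its vertex. -/
def next {n : ℕ} (t : Fin n → ℕ) : Equiv.Perm (Arm t) :=
  Equiv.sumCongr (Equiv.sigmaCongrRight fun i => finRotate (t i))
    (Equiv.prodCongr (Equiv.refl ℕ) (finRotate 4))

/-- The data of a position. -/
structure Position {n : ℕ} (t : Fin n → ℕ) where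
  /-- The number of curves drawn so far. -/
  moves : ℕ
  /-- The pairing of half-edges into edges: `opp d` is the other half of the edge that contains `d`,
  and `opp d = d` if `d` is an open tip (or is not drawn yet). -/
  opp : Equiv.Perm (Arm t)
  /-- The name of the face of the drawing that contains the open tip `d`, or, if `d` is a half-edge,
  of the face next to `d` on the side from which `d` is followed in a boundary walk. -/
  face : Arm t → ℕ

/-- The initial position: `n` spots with `t i` open tips at spot `i`, no curves, one face. -/
def initial {n : ℕ} (t : Fin n → ℕ) : Position t where
  moves := 0
  opp := 1
  face := fun _ => 0

namespace Position

variable {n : ℕ} {t : Fin n → ℕ}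

/-- The arms that are drawn in the position: those of the spots and of the crossbars so far. -/
def Drawn (P : Position t) : Arm t → Prop
  | Sum.inl _ => True
  | Sum.inr (k, _) => k < P.moves

/-- The open tips. -/
def IsTip (P : Position t) (d : Arm t) : Prop := P.Drawn d ∧ P.opp d = d

/-- One step of the walk along the boundary of a face: follow an edge to its other half (or go
around an open tip), then turn to the next arm. The cycles are the boundary components of the faces;
a face has several of them if the drawn graph is disconnected. -/
def boundaryStep (P : Position t) : Equiv.Perm (Arm t) := next t * P.opp

/-- The graph of the position, without regard to multiplicities of edges. -/
def graph (P : Position t) : SimpleGraph (Vertex n) :=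
  SimpleGraph.fromRel fun v w => ∃ d, P.opp d ≠ d ∧ vert d = v ∧ vert (P.opp d) = w

/-- The graph of the position is a simple graph of girth at least `g`: no loop, no two parallel
edges, no cycle of length less than `g`. It is planar since it is drawn without crossings. -/
structure GirthAtLeast (g : ℕ) (P : Position t) : Prop where
  no_loop : ∀ d, P.opp d ≠ d → vert (P.opp d) ≠ vert d
  no_parallel : ∀ d e, P.opp d ≠ d → P.opp e ≠ e → vert d = vert e →
    vert (P.opp d) = vert (P.opp e) → d = e
  girth : (g : ℕ∞) ≤ P.graph.egirth

/-- `Q` arises from `P` by joining the open tips `a ≠ b`, which lie in the same face, by a curve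
inside that face, and drawing a crossbar on the curve.

Arms `0` and `2` of the new vertex complete the edges to `a` and to `b`, and arms `1` and `3`, on
the two sides of the curve, are new open tips. If `a` and `b` lie on the same component of the
boundary of their face, then the curve divides this face into two, one of which gets a new name;
the boundary components that the curve does not touch may go to either of the two. If `a` and `b`
lie on different components, then the face is not divided. The other faces do not change. -/
structure Join (P Q : Position t) (a b : Arm t) : Prop where
  tip_left : P.IsTip a
  tip_right : P.IsTip b
  ne : a ≠ b
  same_face : P.face a = P.face b
  moves_eq : Q.moves = P.moves + 1
  opp_eq : Q.opp =
    P.opp * Equiv.swap a (Sum.inr (P.moves, 0)) * Equiv.swap b (Sum.inr (P.moves, 2))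
  face_drawn : ∀ d, P.Drawn d → Q.face d = P.face d ∨
    (P.boundaryStep.SameCycle a b ∧ P.face d = P.face a ∧ Q.face d = P.moves + 1)
  face_ne : P.boundaryStep.SameCycle a b → Q.face a ≠ Q.face b
  face_boundary : ∀ d, Q.Drawn d → Q.face (Q.boundaryStep d) = Q.face d

/-- A valid move of the game for the family of planar graphs of girth at least `g`. -/
def Move (g : ℕ) (P Q : Position t) : Prop := (∃ a b, P.Join Q a b) ∧ Q.GirthAtLeast g

end Position

/-- The `n`-Brussels sprout game with parameters `t`, for the family of planar graphs of girth at
least `g`, has a play that ends after exactly `N` moves: `N` successive valid moves lead from the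
initial position to a position without valid moves. -/
def HasPlayEndingAfter (g : ℕ) {n : ℕ} (t : Fin n → ℕ) (N : ℕ) : Prop :=
  ∃ s : ℕ → Position t, s 0 = initial t ∧ (∀ i < N, (s i).Move g (s (i + 1))) ∧
    ∀ Q, ¬ (s N).Move g Q

end BrusselsSprout

/-!
The first move joins the two spots `α` and `β`. It leaves a single face, and along its boundary the
open tips are attached to `k`, `β`, …, `β`, `k`, `α`, …, `α`, where `k` is the new crossing. From
then on every move divides a face in two and splits the cyclic word of its tips accordingly, each
half receiving one of the two tips of the crossing just made. A move is valid iff the two vertices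
are distinct and not adjacent, since the new edges then close no triangle and no double edge. So the
rest of the play is a game on words.

For the long play, join again and again a tip of `β` with a tip of `α` in such a way that the cut
off word consists of the new crossing, the previous one and at most one further tip of `β`. These
two or three tips can be used up by one or two moves. As each step uses one tip of `α` and one or
two tips of `β`, the tips of both run out together.

For the short play, join a tip of `β` with a tip of `α` so that only two tips are cut off, which one
more move settles. The two tips of crossings in the large face are now attached to different
crossings, and joining these separates `β` from `α`. One further move on either side makes all
vertices on that side adjacent to the newest crossing: six moves in total.
-/

namespace BrusselsSprout

open Equiv SimpleGraph

section Graph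

variable {V : Type*} {G : SimpleGraph V} {v w x y z : V}

theorem four_le_egirth_iff_cliqueFree_three : 4 ≤ G.egirth ↔ G.CliqueFree 3 := by
  refine le_egirth.trans ⟨fun h s hs => ?_, fun h x p hp => ?_⟩
  · obtain ⟨x, p, hp, hlen⟩ := is3Clique_iff_exists_cycle_length_three.1 ⟨s, hs⟩
    have hle := h x p hp
    rw [hlen] at hle
    exact absurd hle (by decide)
  · have hne : p.length ≠ 3 := fun hlen =>
      let ⟨s, hs⟩ := is3Clique_iff_exists_cycle_length_three.2 ⟨x, p, hp, hlen⟩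
      h s hs
    exact_mod_cast Nat.lt_of_le_of_ne hp.three_le_length hne.symm

/-- The graph `G` together with the path `x`, `z`, `y`. A move of the game adds such a path through
its new crossing `z`. -/
def addPath (G : SimpleGraph V) (x z y : V) : SimpleGraph V := G ⊔ edge z x ⊔ edge z y

theorem addPath_adj : (addPath G x z y).Adj v w ↔ G.Adj v w ∨
    v ≠ w ∧ (v = z ∧ (w = x ∨ w = y) ∨ w = z ∧ (v = x ∨ v = y)) := by
  simp only [addPath, sup_adj, edge_adj]
  tauto

theorem le_addPath : G ≤ addPath G x z y := fun _ _ h => addPath_adj.2 (.inl h)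

theorem not_addPath_adj_of_ne (h : ¬ G.Adj v w) (hv : v ≠ z) (hw : w ≠ z) :
    ¬ (addPath G x z y).Adj v w := by
  simp [addPath_adj, h, hv, hw]

theorem not_addPath_adj_middle (hz : G.IsIsolated z) (hx : w ≠ x) (hy : w ≠ y) :
    ¬ (addPath G x z y).Adj z w := by
  have hzw : ¬ G.Adj z w := hz w
  simp only [addPath_adj]
  grind

theorem cliqueFree_three_addPath (hG : G.CliqueFree 3) (hz : G.IsIsolated z) (hxy : ¬ G.Adj x y) :
    (addPath G x z y).CliqueFree 3 := by
  classical
  intro s hs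
  obtain ⟨u, v, w, huv, huw, hvw, -⟩ := is3Clique_iff.1 hs
  have hfree : ∀ u v w, G.Adj u v → G.Adj u w → ¬ G.Adj v w := fun u v w huv huw hvw =>
    hG _ (is3Clique_triple_iff.2 ⟨huv, huw, hvw⟩)
  have hyx : ¬ G.Adj y x := fun h => hxy h.symm
  have hz' : ∀ v, ¬ G.Adj v z := fun v h => hz v h.symm
  simp only [addPath_adj] at huv huw hvw
  grind [SimpleGraph.IsIsolated]

end Graph

section Cycle

variable {α : Type*} {a b c d : α} {l u v : List α}

theorem isChain_cons_append_congr {f g : α → α} (h : List.IsChain (f · = ·) (a :: (l ++ [b])))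
    (hc : g c = f a) (hfg : ∀ d ∈ l, g d = f d) : List.IsChain (g · = ·) (c :: (l ++ [b])) := by
  induction l generalizing a c with
  | nil => simpa [hc] using h
  | cons e l ih =>
    simp only [List.cons_append, List.isChain_cons_cons] at h ⊢
    exact ⟨hc.trans h.1, ih h.2 (hfg e (by simp)) fun d hd => hfg d (by simp [hd])⟩

theorem cycleChain_congr {f g : α → α} {s : Cycle α} (h : s.Chain (f · = ·))
    (hfg : ∀ d ∈ s, g d = f d) : s.Chain (g · = ·) := by
  induction s using Quotient.inductionOn' with | h l => ?_
  rcases l with _ | ⟨a, l⟩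
  · exact .nil _
  · exact isChain_cons_append_congr h (hfg a (by simp)) fun d hd => hfg d (by simp [hd])

theorem cycleChain_append_iff {r : α → α → Prop} :
    Cycle.Chain r (a :: u ++ b :: v : List α) ↔
      List.IsChain r (a :: (u ++ [b])) ∧ List.IsChain r (b :: (v ++ [a])) := by
  rw [List.cons_append, Cycle.chain_coe_cons, List.append_assoc, List.cons_append,
    ← List.cons_append, List.isChain_split, List.cons_append]

theorem apply_mem_of_cycleChain {f : α → α} {s : Cycle α} (h : s.Chain (f · = ·)) (hd : d ∈ s) :
    f d ∈ s := by
  induction s using Quotient.inductionOn' with | h l => ?_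
  obtain ⟨u, v, rfl⟩ := List.append_of_mem hd
  have hrot : ((u ++ d :: v : List α) : Cycle α) = (d :: (v ++ u) : List α) :=
    Cycle.coe_eq_coe.2 List.isRotated_append
  change ((u ++ d :: v : List α) : Cycle α).Chain _ at h
  change f d ∈ ((u ++ d :: v : List α) : Cycle α)
  rw [hrot, Cycle.chain_coe_cons] at h
  rw [hrot, Cycle.mem_coe_iff]
  generalize v ++ u = w at h ⊢
  rcases w with _ | ⟨e, w⟩
  · simpa using h
  · simpa using .inr (.inl (List.isChain_cons_cons.1 h).1)

theorem sameCycle_of_cycleChain {f : Perm α} {s : Cycle α} (h : s.Chain (f · = ·)) (ha : a ∈ s)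
    (hb : b ∈ s) : f.SameCycle a b := by
  have : IsTrans α f.SameCycle := ⟨fun _ _ _ => .trans⟩
  have hsame : s.Chain f.SameCycle := h.imp fun d e (hde : f d = e) => by
    subst hde
    exact Perm.sameCycle_apply_right.2 (.refl f d)
  exact Cycle.chain_iff_pairwise.1 hsame a ha b hb

theorem mem_of_sameCycle_of_cycleChain {f : Perm α} {s : Cycle α} (h : s.Chain (f · = ·))
    (ha : a ∈ s) (hab : f.SameCycle a b) : b ∈ s := by
  have hfin : Finite {d | d ∈ s} := by
    induction s using Quotient.inductionOn' with | h l => exact l.finite_toSet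
  have hmaps : Set.MapsTo f {d | d ∈ s} {d | d ∈ s} := fun d hd => apply_mem_of_cycleChain h hd
  have hbij : Set.BijOn f {d | d ∈ s} {d | d ∈ s} := ⟨hmaps, f.injective.injOn, fun d hd =>
    ⟨f.symm d, Perm.perm_symm_mapsTo_of_mapsTo f hmaps hd, f.apply_symm_apply d⟩⟩
  obtain ⟨k, rfl⟩ := hab
  exact (hbij.perm_zpow k).mapsTo ha

theorem cycleChain_finRotate_finRange (m : ℕ) :
    Cycle.Chain (finRotate m · = ·) (List.finRange m : Cycle (Fin m)) := by
  rcases m with _ | m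
  · simp
  · have hval : Cycle.Chain (fun x y => (x + 1) % (m + 1) = y)
        ((List.finRange (m + 1) : Cycle (Fin (m + 1))).map Fin.val) := by
      rw [Cycle.map_coe, List.map_coe_finRange_eq_range, Cycle.chain_range_succ]
      exact ⟨Nat.mod_self _, fun k hk => Nat.mod_eq_of_lt (by omega)⟩
    refine ((Cycle.chain_map _).1 hval).imp fun x y hxy => ?_
    rw [finRotate_apply, Fin.ext_iff, Fin.val_add, ← hxy, Fin.val_one', Nat.add_mod_mod]

end Cycle

section Word

open Sum

variable {n : ℕ} {G : SimpleGraph (Vertex n)}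

/-- Moves inside a single face. `WordEndsAfter G w N` says that, when the open tips of the face are
attached to the vertices `w` in this cyclic order and the vertices in `w` are adjacent as in `G`,
some play inside the face gets stuck after exactly `N` moves. Joining two tips splits the face in
two, each of which inherits one of the two tips of the new crossing `m`. Its number depends on the
moves made in other faces, so `m` ranges over all vertices that can be new. -/
inductive WordEndsAfter : SimpleGraph (Vertex n) → List (Vertex n) → ℕ → Prop
  | settled {G : SimpleGraph (Vertex n)} {w : List (Vertex n)}
      (h : ∀ x ∈ w, ∀ y ∈ w, x = y ∨ G.Adj x y) : WordEndsAfter G w 0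
  | join {G : SimpleGraph (Vertex n)} (w₀ u v : List (Vertex n)) {x y : Vertex n} {M N : ℕ}
      (hne : x ≠ y) (hadj : ¬ G.Adj x y)
      (left : ∀ m, inr m ∉ w₀ ++ x :: (u ++ y :: v) → G.IsIsolated (inr m) →
        WordEndsAfter (addPath G x (inr m) y) (inr m :: u) M)
      (right : ∀ m, inr m ∉ w₀ ++ x :: (u ++ y :: v) → G.IsIsolated (inr m) →
        WordEndsAfter (addPath G x (inr m) y) (inr m :: (v ++ w₀)) N) :
      WordEndsAfter G (w₀ ++ x :: (u ++ y :: v)) (M + N + 1)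

namespace WordEndsAfter

variable {x y z : Vertex n}

theorem singleton : WordEndsAfter G [x] 0 :=
  settled (by simp)

theorem cons_replicate_of_adj (h : G.Adj x y) (j : ℕ) :
    WordEndsAfter G (x :: List.replicate j y) 0 := by
  refine settled ?_
  simp only [List.mem_cons, List.mem_replicate]
  rintro _ (rfl | ⟨-, rfl⟩) _ (rfl | ⟨-, rfl⟩)
  exacts [.inl rfl, .inr h, .inr h.symm, .inl rfl]

theorem cons_replicate_of_not_adj (hne : x ≠ y) (hadj : ¬ G.Adj x y) (j : ℕ) :
    WordEndsAfter G (x :: List.replicate (j + 1) y) 1 :=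
  join (M := 0) (N := 0) [] [] (List.replicate j y) hne hadj (fun _ _ _ => singleton)
    fun m hm _ => by
      rw [List.append_nil]
      exact cons_replicate_of_adj (addPath_adj.2 (.inr ⟨by simp_all, by simp⟩)) j

theorem pair (hne : x ≠ y) (hadj : ¬ G.Adj x y) : WordEndsAfter G [x, y] 1 :=
  cons_replicate_of_not_adj hne hadj 0

theorem triple_of_first_second (hne : x ≠ y) (hadj : ¬ G.Adj x y) (hzx : z ≠ x) (hzy : z ≠ y) :
    WordEndsAfter G [x, y, z] 2 :=
  join [] [] [z] hne hadj (fun _ _ _ => singleton) fun m hm hiso =>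
    pair (by simp_all) (not_addPath_adj_middle hiso hzx hzy)

theorem triple_of_first_third (hne : x ≠ y) (hadj : ¬ G.Adj x y) (hzx : z ≠ x) (hzy : z ≠ y) :
    WordEndsAfter G [x, z, y] 2 :=
  join [] [z] [] hne hadj (fun m hm hiso =>
    pair (by simp_all) (not_addPath_adj_middle hiso hzx hzy))
    fun _ _ _ => singleton

end WordEndsAfter

/-- The words met in the play: after the first move, `k = k'` is the crossing between the spots `α`
and `β`, which have kept `i` and `j` tips. -/
def mainWord (α β : Fin n) (k k' i j : ℕ) : List (Vertex n) :=
  inr k :: (List.replicate j (inl β) ++ inr k' :: List.replicate i (inl α))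

namespace WordEndsAfter

variable {α β : Fin n} {k k' i j : ℕ}

theorem mainWord_of_not_adj (hk : k ≠ k') (hkk : ¬ G.Adj (inr k) (inr k')) :
    WordEndsAfter G (mainWord α β k k' (i + 1) (j + 1)) 3 :=
  join (M := 1) (N := 1) [] (List.replicate (j + 1) (inl β)) (List.replicate (i + 1) (inl α))
    (by simpa using hk) hkk
    (fun _ _ hm => cons_replicate_of_not_adj (by simp)
      (not_addPath_adj_middle hm (by simp) (by simp)) j)
    fun _ _ hm => by
      rw [List.append_nil]
      exact cons_replicate_of_not_adj (by simp) (not_addPath_adj_middle hm (by simp) (by simp)) i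

theorem mainWord_succ_succ {M N r : ℕ} (hαβ : α ≠ β) (hadj : ¬ G.Adj (inl β) (inl α))
    (left : ∀ m, m ≠ k' → ¬ (addPath G (inl β) (inr m) (inl α)).Adj (inl β) (inl α) →
      ¬ (addPath G (inl β) (inr m) (inl α)).Adj (inr m) (inr k') →
      WordEndsAfter (addPath G (inl β) (inr m) (inl α)) (mainWord α β m k' i j) M)
    (right : ∀ m, m ≠ k → ¬ (addPath G (inl β) (inr m) (inl α)).Adj (inr m) (inr k) →
      WordEndsAfter (addPath G (inl β) (inr m) (inl α))
        (inr m :: inr k :: List.replicate r (inl β)) N) :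
    WordEndsAfter G (mainWord α β k k' (i + 1) (j + 1 + r)) (M + N + 1) := by
  have hword : mainWord α β k k' (i + 1) (j + 1 + r) =
      (inr k :: List.replicate r (inl β)) ++
        inl β :: ((List.replicate j (inl β) ++ inr k' :: List.replicate i (inl α)) ++ [inl α]) := by
    have hβ : List.replicate (j + 1 + r) (inl β : Vertex n) =
        List.replicate r (inl β) ++ inl β :: List.replicate j (inl β) := by
      rw [← List.replicate_succ, List.replicate_append_replicate, add_comm]
    simp [mainWord, hβ, List.replicate_succ']
  rw [hword]
  refine join _ _ [] (by simpa using hαβ.symm) hadj (fun m hm hiso => ?_) fun m hm hiso => ?_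
  · exact left m (by rintro rfl; simp at hm) (not_addPath_adj_of_ne hadj (by simp) (by simp))
      (not_addPath_adj_middle hiso (by simp) (by simp))
  · exact right m (by rintro rfl; simp at hm) (not_addPath_adj_middle hiso (by simp) (by simp))

theorem mainWord_five (hαβ : α ≠ β) (hadj : ¬ G.Adj (inl β) (inl α)) :
    WordEndsAfter G (mainWord α β k k' (i + 2) (j + 2)) 5 :=
  mainWord_succ_succ (M := 3) (N := 1) (r := 0) hαβ hadj
    (fun _ hm _ hmk => mainWord_of_not_adj hm hmk)
    fun _ hm hmk => pair (by simpa using hm) hmk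

theorem mainWord_longest (hαβ : α ≠ β) (hadj : ¬ G.Adj (inl β) (inl α)) (hk : i = 0 → k ≠ k')
    (hkk : ¬ G.Adj (inr k) (inr k')) (hij : i ≤ j) (hji : j ≤ 2 * i + 1) :
    WordEndsAfter G (mainWord α β k k' i j) (i + j + 1) := by
  induction i generalizing G k j with
  | zero =>
    have hne : (inr k : Vertex n) ≠ inr k' := by simpa using hk
    obtain rfl | rfl : j = 0 ∨ j = 1 := by omega
    · exact pair hne hkk
    · exact triple_of_first_third hne hkk (by simp) (by simp)
  | succ i ih =>
    -- The bound on `j` survives for `i` if, when necessary, two tips of `β` are used up.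
    obtain ⟨j', r, hr, rfl, hij', hji'⟩ :
        ∃ j' r, r ≤ 1 ∧ j = j' + 1 + r ∧ i ≤ j' ∧ j' ≤ 2 * i + 1 := by
      by_cases h : j ≤ 2 * i + 2
      · exact ⟨j - 1, 0, by omega⟩
      · exact ⟨j - 2, 1, by omega⟩
    have hlen : i + 1 + (j' + 1 + r) + 1 = (i + j' + 1) + (r + 1) + 1 := by omega
    rw [hlen]
    refine mainWord_succ_succ hαβ hadj (fun m hm hadj' hmk => ih hadj' (fun _ => hm) hmk hij' hji')
      fun m hm hmk => ?_
    have hne : (inr m : Vertex n) ≠ inr k := by simpa using hm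
    obtain rfl | rfl : r = 0 ∨ r = 1 := by omega
    · exact pair hne hmk
    · exact triple_of_first_second hne hmk (by simp) (by simp)

end WordEndsAfter

end Word

namespace Position

section Edges

variable {n : ℕ} {t : Fin n → ℕ} {P Q : Position t} {a b d : Arm t} {v w : Vertex n}

theorem not_drawn_new (s : Fin 4) : ¬ P.Drawn (.inr (P.moves, s)) := lt_irrefl P.moves

theorem Drawn.ne_new (h : P.Drawn d) (s : Fin 4) : d ≠ .inr (P.moves, s) := by
  rintro rfl
  exact not_drawn_new s h

theorem Drawn.vert_ne (h : P.Drawn d) : vert d ≠ .inr P.moves := by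
  rcases d with d | ⟨k, s⟩
  · simp [vert]
  · exact fun hk => h.ne (Sum.inr_injective hk)

/-- The pairing of arms into edges is symmetric, and it only concerns arms that are drawn. -/
structure WellFormed (P : Position t) : Prop where
  opp_opp : ∀ d, P.opp (P.opp d) = d
  opp_undrawn : ∀ d, ¬ P.Drawn d → P.opp d = d

namespace WellFormed

theorem drawn_of_opp_ne (hP : P.WellFormed) (hd : P.opp d ≠ d) : P.Drawn d :=
  not_imp_comm.1 (hP.opp_undrawn d) hd

theorem opp_opp_ne (hP : P.WellFormed) (hd : P.opp d ≠ d) : P.opp (P.opp d) ≠ P.opp d := by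
  rwa [hP.opp_opp, ne_comm]

theorem graph_adj (hP : P.WellFormed) :
    P.graph.Adj v w ↔ v ≠ w ∧ ∃ d, P.opp d ≠ d ∧ vert d = v ∧ vert (P.opp d) = w := by
  rw [graph, fromRel_adj]
  refine and_congr_right fun _ => ⟨?_, Or.inl⟩
  rintro (h | ⟨d, hd, rfl, rfl⟩)
  · exact h
  · exact ⟨P.opp d, hP.opp_opp_ne hd, rfl, by rw [hP.opp_opp]⟩

theorem isIsolated_of_le (hP : P.WellFormed) {m : ℕ} (hm : P.moves ≤ m) :
    P.graph.IsIsolated (.inr m) := by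
  rintro v hv
  obtain ⟨-, d, hd, hdm, -⟩ := hP.graph_adj.1 hv
  have hdrawn := hP.drawn_of_opp_ne hd
  rcases d with d | ⟨k, s⟩
  · simp [vert] at hdm
  · obtain rfl : k = m := Sum.inr_injective hdm
    exact hdrawn.not_ge hm

end WellFormed

/-- The part of `Join` that does not mention faces: `Q` has the vertices and the edges of the
well-formed position `P`, and those that arise when the tips `a` and `b` are joined. -/
structure Links (P Q : Position t) (a b : Arm t) : Prop where
  wellFormed : P.WellFormed
  tip_left : P.IsTip a
  tip_right : P.IsTip b
  ne : a ≠ b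
  moves_eq : Q.moves = P.moves + 1
  opp_eq : Q.opp = P.opp * swap a (.inr (P.moves, 0)) * swap b (.inr (P.moves, 2))

theorem Join.links (h : P.Join Q a b) (hP : P.WellFormed) : P.Links Q a b where
  wellFormed := hP
  __ := h

namespace Links

theorem drawn_iff (h : P.Links Q a b) : Q.Drawn d ↔ P.Drawn d ∨ ∃ s, d = .inr (P.moves, s) := by
  rcases d with d | ⟨k, s⟩
  · simp [Drawn]
  · simp [Drawn, h.moves_eq, le_iff_lt_or_eq]

theorem opp_left (h : P.Links Q a b) : Q.opp a = .inr (P.moves, 0) := by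
  simp [h.opp_eq, swap_apply_of_ne_of_ne h.ne (h.tip_left.1.ne_new 2),
    h.wellFormed.opp_undrawn _ (not_drawn_new 0)]

theorem opp_right (h : P.Links Q a b) : Q.opp b = .inr (P.moves, 2) := by
  simp [h.opp_eq, swap_apply_of_ne_of_ne (h.tip_left.1.ne_new 2).symm,
    h.wellFormed.opp_undrawn _ (not_drawn_new 2)]

theorem opp_zero (h : P.Links Q a b) : Q.opp (.inr (P.moves, 0)) = a := by
  simp [h.opp_eq, swap_apply_of_ne_of_ne (h.tip_right.1.ne_new 0).symm, h.tip_left.2]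

theorem opp_two (h : P.Links Q a b) : Q.opp (.inr (P.moves, 2)) = b := by
  simp [h.opp_eq, swap_apply_of_ne_of_ne h.ne.symm (h.tip_right.1.ne_new 0), h.tip_right.2]

theorem opp_of_ne (h : P.Links Q a b) (ha : d ≠ a) (hb : d ≠ b) (h0 : d ≠ .inr (P.moves, 0))
    (h2 : d ≠ .inr (P.moves, 2)) : Q.opp d = P.opp d := by
  simp [h.opp_eq, swap_apply_of_ne_of_ne, ha, hb, h0, h2]

theorem opp_of_drawn (h : P.Links Q a b) (hd : P.Drawn d) (ha : d ≠ a) (hb : d ≠ b) :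
    Q.opp d = P.opp d :=
  h.opp_of_ne ha hb (hd.ne_new 0) (hd.ne_new 2)

theorem opp_of_opp_ne (h : P.Links Q a b) (hd : P.opp d ≠ d) : Q.opp d = P.opp d := by
  refine h.opp_of_drawn (h.wellFormed.drawn_of_opp_ne hd) ?_ ?_
  · rintro rfl
    exact hd h.tip_left.2
  · rintro rfl
    exact hd h.tip_right.2

theorem opp_one (h : P.Links Q a b) : Q.opp (.inr (P.moves, 1)) = .inr (P.moves, 1) := by
  rw [h.opp_of_ne (h.tip_left.1.ne_new 1).symm (h.tip_right.1.ne_new 1).symm (by simp) (by simp),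
    h.wellFormed.opp_undrawn _ (not_drawn_new 1)]

theorem opp_three (h : P.Links Q a b) : Q.opp (.inr (P.moves, 3)) = .inr (P.moves, 3) := by
  rw [h.opp_of_ne (h.tip_left.1.ne_new 3).symm (h.tip_right.1.ne_new 3).symm (by simp) (by simp),
    h.wellFormed.opp_undrawn _ (not_drawn_new 3)]

theorem opp_ne_iff (h : P.Links Q a b) : Q.opp d ≠ d ↔
    d = a ∨ d = b ∨ d = .inr (P.moves, 0) ∨ d = .inr (P.moves, 2) ∨ P.opp d ≠ d := by
  have ha := h.tip_left.1.ne_new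
  have hb := h.tip_right.1.ne_new
  constructor
  · intro hd
    by_contra! hcases
    obtain ⟨ha, hb, h0, h2, hd'⟩ := hcases
    exact hd ((h.opp_of_ne ha hb h0 h2).trans hd')
  · rintro (rfl | rfl | rfl | rfl | hd)
    · exact h.opp_left ▸ (ha 0).symm
    · exact h.opp_right ▸ (hb 2).symm
    · exact h.opp_zero ▸ ha 0
    · exact h.opp_two ▸ hb 2
    · rwa [h.opp_of_opp_ne hd]

theorem wellFormed_right (h : P.Links Q a b) : Q.WellFormed where
  opp_opp d := by
    by_cases hd : Q.opp d = d
    · rw [hd, hd]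
    rcases h.opp_ne_iff.1 hd with rfl | rfl | rfl | rfl | hd
    · rw [h.opp_left, h.opp_zero]
    · rw [h.opp_right, h.opp_two]
    · rw [h.opp_zero, h.opp_left]
    · rw [h.opp_two, h.opp_right]
    · rw [h.opp_of_opp_ne hd, h.opp_of_opp_ne (h.wellFormed.opp_opp_ne hd), h.wellFormed.opp_opp]
  opp_undrawn d hd := by
    by_contra hne
    refine hd (h.drawn_iff.2 ?_)
    rcases h.opp_ne_iff.1 hne with rfl | rfl | rfl | rfl | hd
    exacts [.inl h.tip_left.1, .inl h.tip_right.1, .inr ⟨0, rfl⟩, .inr ⟨2, rfl⟩,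
      .inl (h.wellFormed.drawn_of_opp_ne hd)]

theorem graph_eq (h : P.Links Q a b) :
    Q.graph = addPath P.graph (vert a) (.inr P.moves) (vert b) := by
  ext v w
  rw [addPath_adj, h.wellFormed_right.graph_adj, h.wellFormed.graph_adj]
  constructor
  · rintro ⟨hvw, d, hd, rfl, rfl⟩
    rcases h.opp_ne_iff.1 hd with rfl | rfl | rfl | rfl | hd
    · exact .inr ⟨hvw, .inr ⟨by rw [h.opp_left]; rfl, .inl rfl⟩⟩
    · exact .inr ⟨hvw, .inr ⟨by rw [h.opp_right]; rfl, .inr rfl⟩⟩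
    · exact .inr ⟨hvw, .inl ⟨rfl, .inl (by rw [h.opp_zero])⟩⟩
    · exact .inr ⟨hvw, .inl ⟨rfl, .inr (by rw [h.opp_two])⟩⟩
    · exact .inl ⟨hvw, d, hd, rfl, by rw [h.opp_of_opp_ne hd]⟩
  · rintro (⟨hvw, d, hd, rfl, rfl⟩ | ⟨hvw, ⟨rfl, rfl | rfl⟩ | ⟨rfl, rfl | rfl⟩⟩) <;>
      refine ⟨hvw, ?_⟩
    · exact ⟨d, h.opp_ne_iff.2 (by simp [hd]), rfl, by rw [h.opp_of_opp_ne hd]⟩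
    · exact ⟨.inr (P.moves, 0), h.opp_ne_iff.2 (by simp), rfl, by rw [h.opp_zero]⟩
    · exact ⟨.inr (P.moves, 2), h.opp_ne_iff.2 (by simp), rfl, by rw [h.opp_two]⟩
    · exact ⟨a, h.opp_ne_iff.2 (by simp), rfl, by rw [h.opp_left]; rfl⟩
    · exact ⟨b, h.opp_ne_iff.2 (by simp), rfl, by rw [h.opp_right]; rfl⟩

theorem edge_cases (h : P.Links Q a b) (hd : Q.opp d ≠ d) :
    (d = a ∨ d = b) ∧ vert (Q.opp d) = .inr P.moves ∨
    (d = .inr (P.moves, 0) ∧ vert (Q.opp d) = vert a ∨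
      d = .inr (P.moves, 2) ∧ vert (Q.opp d) = vert b) ∨
    P.opp d ≠ d ∧ Q.opp d = P.opp d ∧ vert d ≠ .inr P.moves ∧ vert (Q.opp d) ≠ .inr P.moves := by
  rcases h.opp_ne_iff.1 hd with rfl | rfl | rfl | rfl | hd
  · exact .inl ⟨.inl rfl, by rw [h.opp_left]; rfl⟩
  · exact .inl ⟨.inr rfl, by rw [h.opp_right]; rfl⟩
  · exact .inr (.inl (.inl ⟨rfl, by rw [h.opp_zero]⟩))
  · exact .inr (.inl (.inr ⟨rfl, by rw [h.opp_two]⟩))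
  · have hdrawn := h.wellFormed.drawn_of_opp_ne hd
    have hopp := h.wellFormed.drawn_of_opp_ne (h.wellFormed.opp_opp_ne hd)
    rw [h.opp_of_opp_ne hd]
    exact .inr (.inr ⟨hd, rfl, hdrawn.vert_ne, hopp.vert_ne⟩)

theorem girthAtLeast_four_iff (h : P.Links Q a b) (hP : P.GirthAtLeast 4) :
    Q.GirthAtLeast 4 ↔ vert a ≠ vert b ∧ ¬ P.graph.Adj (vert a) (vert b) := by
  have ha : vert a ≠ .inr P.moves := h.tip_left.1.vert_ne
  have hb : vert b ≠ .inr P.moves := h.tip_right.1.vert_ne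
  have hnew (s : Fin 4) : vert (.inr (P.moves, s) : Arm t) = .inr P.moves := rfl
  refine ⟨fun hQ => ⟨fun hab => h.ne ?_, fun hadj => ?_⟩, fun ⟨_, hadj⟩ => ⟨?_, ?_, ?_⟩⟩
  · refine hQ.no_parallel a b (h.opp_ne_iff.2 (by simp)) (h.opp_ne_iff.2 (by simp)) hab ?_
    rw [h.opp_left, h.opp_right, hnew, hnew]
  · refine four_le_egirth_iff_cliqueFree_three.1 hQ.girth {vert a, .inr P.moves, vert b} ?_
    rw [h.graph_eq, is3Clique_triple_iff]
    simp [addPath_adj, ha, hb, ha.symm, hb.symm, hadj]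
  · intro d hd
    have := h.edge_cases hd
    have := hP.no_loop d
    grind
  · intro d e hd he
    have := h.edge_cases hd
    have := h.edge_cases he
    have := hP.no_parallel d e
    grind
  · rw [h.graph_eq]
    exact four_le_egirth_iff_cliqueFree_three.2 (cliqueFree_three_addPath
      (four_le_egirth_iff_cliqueFree_three.1 hP.girth) (h.wellFormed.isIsolated_of_le le_rfl) hadj)

theorem boundaryStep_left (h : P.Links Q a b) : Q.boundaryStep a = .inr (P.moves, 1) := by
  simp [boundaryStep, h.opp_left, next]

theorem boundaryStep_right (h : P.Links Q a b) : Q.boundaryStep b = .inr (P.moves, 3) := by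
  simp [boundaryStep, h.opp_right, next]

theorem boundaryStep_zero (h : P.Links Q a b) :
    Q.boundaryStep (.inr (P.moves, 0)) = P.boundaryStep a := by
  simp [boundaryStep, h.opp_zero, h.tip_left.2]

theorem boundaryStep_one (h : P.Links Q a b) :
    Q.boundaryStep (.inr (P.moves, 1)) = .inr (P.moves, 2) := by
  simp [boundaryStep, h.opp_one, next]

theorem boundaryStep_two (h : P.Links Q a b) :
    Q.boundaryStep (.inr (P.moves, 2)) = P.boundaryStep b := by
  simp [boundaryStep, h.opp_two, h.tip_right.2]

theorem boundaryStep_three (h : P.Links Q a b) :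
    Q.boundaryStep (.inr (P.moves, 3)) = .inr (P.moves, 0) := by
  simp [boundaryStep, h.opp_three, next]

end Links

end Edges

section Faces

variable {n : ℕ} {t : Fin n → ℕ} {P Q R : Position t} {a b d : Arm t} {ψ : ℕ}
  {l c₁ c₂ : List (Arm t)}

/-- The face `φ` has a single boundary component, the cycle `c` of arms. The empty cycle is allowed:
it says that no arm lies in `φ`. -/
structure IsBoundary (P : Position t) (φ : ℕ) (c : Cycle (Arm t)) : Prop where
  nodup : c.Nodup
  chain : c.Chain (P.boundaryStep · = ·)
  mem_iff : ∀ d, d ∈ c ↔ P.Drawn d ∧ P.face d = φ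

/-- The face `ψ` consists of the same arms, with the same pairing, in `P` and in `Q`. -/
structure Keeps (P Q : Position t) (ψ : ℕ) : Prop where
  mem_iff : ∀ d, Q.Drawn d ∧ Q.face d = ψ ↔ P.Drawn d ∧ P.face d = ψ
  opp_eq : ∀ d, P.Drawn d → P.face d = ψ → Q.opp d = P.opp d

theorem Keeps.trans (h : P.Keeps Q ψ) (h' : Q.Keeps R ψ) : P.Keeps R ψ where
  mem_iff d := (h'.mem_iff d).trans (h.mem_iff d)
  opp_eq d hd hψ := by
    have hQ := (h.mem_iff d).2 ⟨hd, hψ⟩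
    rw [h'.opp_eq d hQ.1 hQ.2, h.opp_eq d hd hψ]

theorem Keeps.isBoundary (h : P.Keeps Q ψ) {c : Cycle (Arm t)} (hc : P.IsBoundary ψ c) :
    Q.IsBoundary ψ c where
  nodup := hc.nodup
  chain := cycleChain_congr hc.chain fun d hd => by
    have hP := (hc.mem_iff d).1 hd
    simp only [boundaryStep, Perm.mul_apply, h.opp_eq d hP.1 hP.2]
  mem_iff d := (hc.mem_iff d).trans (h.mem_iff d).symm

/-- The positions that occur in the plays of the theorem: well formed, of girth at least `4`, with
faces named by numbers up to the number of moves, which are unions of boundary components. -/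
structure Regular (P : Position t) : Prop extends P.WellFormed where
  girth : P.GirthAtLeast 4
  face_le : ∀ d, P.Drawn d → P.face d ≤ P.moves
  face_boundaryStep : ∀ d, P.Drawn d → P.face (P.boundaryStep d) = P.face d

theorem drawn_next_iff : P.Drawn (next t d) ↔ P.Drawn d := by
  rcases d with d | ⟨k, s⟩ <;> rfl

theorem WellFormed.drawn_boundaryStep (hP : P.WellFormed) (hd : P.Drawn d) :
    P.Drawn (P.boundaryStep d) := by
  rw [boundaryStep, Perm.mul_apply, drawn_next_iff]
  by_cases h : P.opp d = d
  · rwa [h]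
  · exact hP.drawn_of_opp_ne (hP.opp_opp_ne h)

/-- The four arms of the crossing that the next move creates. -/
def newArms (P : Position t) : List (Arm t) :=
  [.inr (P.moves, 0), .inr (P.moves, 1), .inr (P.moves, 2), .inr (P.moves, 3)]

theorem mem_newArms : d ∈ P.newArms ↔ ∃ s, d = .inr (P.moves, s) := by
  simp [newArms, Fin.exists_fin_succ]

theorem nodup_newArms : P.newArms.Nodup := by
  simp [newArms]

open scoped Classical in
/-- The position after joining `a` and `b`, where the arms in `c` form the new face. -/
noncomputable def join (P : Position t) (a b : Arm t) (c : List (Arm t)) : Position t where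
  moves := P.moves + 1
  opp := P.opp * swap a (.inr (P.moves, 0)) * swap b (.inr (P.moves, 2))
  face d := if d ∈ c then P.moves + 1 else if d ∈ P.newArms then P.face a else P.face d

/-- Joining `a` and `b` leads from `P` to `Q`. Afterwards `c₁` bounds the old face of `a` and `b`,
and `c₂` bounds the face with the new name, where `c₂` is empty if the face is not divided. The
other faces do not change. -/
structure Divides (P Q : Position t) (a b : Arm t) (c₁ c₂ : List (Arm t)) : Prop where
  links : P.Links Q a b
  same_face : P.face a = P.face b
  isBoundary_old : Q.IsBoundary (P.face a) c₁
  isBoundary_new : Q.IsBoundary (P.moves + 1) c₂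
  keeps : ∀ ψ ≤ P.moves, ψ ≠ P.face a → P.Keeps Q ψ
  face_le : ∀ d, Q.Drawn d → Q.face d ≤ P.moves + 1
  mem_old : a ∈ c₁
  mem_new : P.boundaryStep.SameCycle a b → b ∈ c₂
  eq_nil : ¬ P.boundaryStep.SameCycle a b → c₂ = []

namespace Divides

theorem face_boundaryStep (h : P.Divides Q a b c₁ c₂) (hP : P.Regular) (hd : Q.Drawn d) :
    Q.face (Q.boundaryStep d) = Q.face d := by
  by_cases hold : Q.face d = P.face a
  · rw [hold]
    have hmem := (h.isBoundary_old.mem_iff d).2 ⟨hd, hold⟩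
    exact ((h.isBoundary_old.mem_iff _).1
      (apply_mem_of_cycleChain h.isBoundary_old.chain hmem)).2
  by_cases hnew : Q.face d = P.moves + 1
  · rw [hnew]
    have hmem := (h.isBoundary_new.mem_iff d).2 ⟨hd, hnew⟩
    exact ((h.isBoundary_new.mem_iff _).1
      (apply_mem_of_cycleChain h.isBoundary_new.chain hmem)).2
  have hkeeps := h.keeps (Q.face d) (Nat.le_of_lt_succ ((h.face_le d hd).lt_of_ne hnew)) hold
  obtain ⟨hdP, hface⟩ := (hkeeps.mem_iff d).1 ⟨hd, rfl⟩
  have hstep : Q.boundaryStep d = P.boundaryStep d := by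
    simp only [boundaryStep, Perm.mul_apply, hkeeps.opp_eq d hdP hface]
  rw [hstep]
  exact ((hkeeps.mem_iff _).2
    ⟨hP.drawn_boundaryStep hdP, (hP.face_boundaryStep d hdP).trans hface⟩).2

theorem regular (h : P.Divides Q a b c₁ c₂) (hP : P.Regular) (hne : vert a ≠ vert b)
    (hadj : ¬ P.graph.Adj (vert a) (vert b)) : Q.Regular where
  toWellFormed := h.links.wellFormed_right
  girth := (h.links.girthAtLeast_four_iff hP.girth).2 ⟨hne, hadj⟩
  face_le d hd := (h.face_le d hd).trans_eq h.links.moves_eq.symm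
  face_boundaryStep _ := h.face_boundaryStep hP

theorem join (h : P.Divides Q a b c₁ c₂) (hP : P.Regular) : P.Join Q a b where
  __ := h.links
  same_face := h.same_face
  face_drawn d hd := by
    have hdQ : Q.Drawn d := h.links.drawn_iff.2 (.inl hd)
    by_cases hnew : Q.face d = P.moves + 1
    · have hmem : d ∈ c₂ := (h.isBoundary_new.mem_iff d).2 ⟨hdQ, hnew⟩
      refine .inr ⟨by_contra fun hcycle => ?_, by_contra fun hold => ?_, hnew⟩
      · simp [h.eq_nil hcycle] at hmem
      · have hface := (((h.keeps _ (hP.face_le d hd) hold).mem_iff d).2 ⟨hd, rfl⟩).2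
        exact (hnew.symm.trans hface).not_gt (Nat.lt_succ_of_le (hP.face_le d hd))
    · left
      by_cases hold : Q.face d = P.face a
      · by_contra hface
        have hkeeps := h.keeps _ (hP.face_le d hd) (hold ▸ Ne.symm hface)
        exact hface ((hkeeps.mem_iff d).2 ⟨hd, rfl⟩).2
      · have hle := Nat.le_of_lt_succ ((h.face_le d hdQ).lt_of_ne hnew)
        exact (((h.keeps _ hle hold).mem_iff d).1 ⟨hdQ, rfl⟩).2.symm
  face_ne hcycle := by
    have ha := ((h.isBoundary_old.mem_iff a).1 h.mem_old).2
    have hb := ((h.isBoundary_new.mem_iff b).1 (h.mem_new hcycle)).2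
    have hle := hP.face_le a h.links.tip_left.1
    omega
  face_boundary _ := h.face_boundaryStep hP

end Divides

theorem drawn_join_iff : (P.join a b l).Drawn d ↔ P.Drawn d ∨ d ∈ P.newArms := by
  rcases d with d | ⟨k, s⟩
  · simp [Drawn]
  · simp [Drawn, join, mem_newArms, le_iff_lt_or_eq]

theorem Drawn.notMem_newArms (hd : P.Drawn d) : d ∉ P.newArms := fun h =>
  have ⟨s, hs⟩ := mem_newArms.1 h
  hd.ne_new s hs

section Join

variable (hP : P.Regular) (ha : P.IsTip a) (hb : P.IsTip b) (hne : a ≠ b) (hl : l.Nodup)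
  (hmem : ∀ d, d ∈ l ↔ P.Drawn d ∧ P.face d = P.face a) (hbl : b ∈ l)
  (hperm : (c₁ ++ c₂).Perm (l ++ P.newArms))

include hP ha hb hne in
theorem Regular.links_join : P.Links (P.join a b c₂) a b where
  wellFormed := hP.toWellFormed
  tip_left := ha
  tip_right := hb
  ne := hne
  moves_eq := rfl
  opp_eq := rfl

include hl hmem hperm in
theorem nodup_append_of_perm : (c₁ ++ c₂).Nodup := by
  rw [hperm.nodup_iff]
  exact hl.append nodup_newArms fun d hd => ((hmem d).1 hd).1.notMem_newArms

include hP ha hl hmem hperm in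
theorem Regular.face_join_cases :
    (d ∈ c₁ ↔ (P.join a b c₂).Drawn d ∧ (P.join a b c₂).face d = P.face a) ∧
    (d ∈ c₂ ↔ (P.join a b c₂).Drawn d ∧ (P.join a b c₂).face d = P.moves + 1) ∧
    (∀ ψ ≤ P.moves, ψ ≠ P.face a →
      ((P.join a b c₂).Drawn d ∧ (P.join a b c₂).face d = ψ ↔ P.Drawn d ∧ P.face d = ψ)) ∧
    ((P.join a b c₂).Drawn d → (P.join a b c₂).face d ≤ P.moves + 1) := by
  classical
  have hdisj : d ∈ c₁ → d ∉ c₂ := fun h =>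
    (List.disjoint_of_nodup_append (nodup_append_of_perm hl hmem hperm) h ·)
  have hcover : d ∈ c₁ ∨ d ∈ c₂ ↔ (P.Drawn d ∧ P.face d = P.face a) ∨ d ∈ P.newArms := by
    rw [← hmem, ← List.mem_append, hperm.mem_iff, List.mem_append]
  have hle := hP.face_le a ha.1
  have hle' := hP.face_le d
  have hnew := Drawn.notMem_newArms (P := P) (d := d)
  have hface : (P.join a b c₂).face d =
      if d ∈ c₂ then P.moves + 1 else if d ∈ P.newArms then P.face a else P.face d := by
    simp only [join]
  rw [drawn_join_iff, hface]
  clear hface hperm hmem hP ha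
  grind

include hP ha hb hne hmem hl hbl hperm in
theorem Regular.divides_join
    (hc₁ : Cycle.Chain ((P.join a b c₂).boundaryStep · = ·) (c₁ : Cycle (Arm t)))
    (hc₂ : Cycle.Chain ((P.join a b c₂).boundaryStep · = ·) (c₂ : Cycle (Arm t)))
    (hold : a ∈ c₁) (hnew : P.boundaryStep.SameCycle a b → b ∈ c₂)
    (hnil : ¬ P.boundaryStep.SameCycle a b → c₂ = []) :
    P.Divides (P.join a b c₂) a b c₁ c₂ := by
  have hlinks : P.Links (P.join a b c₂) a b := hP.links_join ha hb hne
  have hcases d := hP.face_join_cases (b := b) (d := d) ha hl hmem hperm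
  have hnodup := nodup_append_of_perm hl hmem hperm
  have hface : P.face b = P.face a := ((hmem b).1 hbl).2
  exact
    { links := hlinks
      same_face := hface.symm
      isBoundary_old := ⟨hnodup.of_append_left, hc₁, fun d => (hcases d).1⟩
      isBoundary_new := ⟨hnodup.of_append_right, hc₂, fun d => (hcases d).2.1⟩
      keeps := fun ψ hψ hψa => ⟨fun d => (hcases d).2.2.1 ψ hψ hψa, fun d hd hdψ =>
        hlinks.opp_of_drawn hd (by grind) (by grind)⟩
      face_le := fun d => (hcases d).2.2.2
      mem_old := hold
      mem_new := hnew
      eq_nil := hnil }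

end Join

end Faces

section Curves

variable {n : ℕ} {t : Fin n → ℕ} {P Q : Position t} {a b c : Arm t} {φ : ℕ}
  {u v : List (Arm t)}

namespace Links

theorem boundaryStep_of_drawn (h : P.Links Q a b) (hd : P.Drawn d) (ha : d ≠ a) (hb : d ≠ b) :
    Q.boundaryStep d = P.boundaryStep d := by
  simp only [boundaryStep, Perm.mul_apply, h.opp_of_drawn hd ha hb]

/-- On one side of the curve the boundary walk leads from `a` to the tip `1` of the crossing, then
to its arm `2`, and from there on as it used to lead from `b`. -/
theorem isChain_from_left (h : P.Links Q a b) (hv : ∀ d ∈ v, P.Drawn d ∧ d ≠ a ∧ d ≠ b)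
    (hchain : List.IsChain (P.boundaryStep · = ·) (b :: (v ++ [c]))) :
    List.IsChain (Q.boundaryStep · = ·)
      (a :: .inr (P.moves, 1) :: .inr (P.moves, 2) :: (v ++ [c])) := by
  simp only [List.isChain_cons_cons, h.boundaryStep_left, h.boundaryStep_one, true_and]
  exact isChain_cons_append_congr hchain h.boundaryStep_two fun d hd =>
    h.boundaryStep_of_drawn (hv d hd).1 (hv d hd).2.1 (hv d hd).2.2

theorem isChain_from_right (h : P.Links Q a b) (hu : ∀ d ∈ u, P.Drawn d ∧ d ≠ a ∧ d ≠ b)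
    (hchain : List.IsChain (P.boundaryStep · = ·) (a :: (u ++ [c]))) :
    List.IsChain (Q.boundaryStep · = ·)
      (b :: .inr (P.moves, 3) :: .inr (P.moves, 0) :: (u ++ [c])) := by
  simp only [List.isChain_cons_cons, h.boundaryStep_right, h.boundaryStep_three, true_and]
  exact isChain_cons_append_congr hchain h.boundaryStep_zero fun d hd =>
    h.boundaryStep_of_drawn (hu d hd).1 (hu d hd).2.1 (hu d hd).2.2

end Links

theorem perm_append_newArms :
    ((a :: .inr (P.moves, 1) :: .inr (P.moves, 2) :: v) ++
      (b :: .inr (P.moves, 3) :: .inr (P.moves, 0) :: u)).Perm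
    ((a :: u ++ b :: v) ++ P.newArms) := by
  rw [← Multiset.coe_eq_coe]
  simp only [newArms, ← Multiset.coe_add, ← Multiset.cons_coe, Multiset.coe_nil,
    ← Multiset.singleton_add]
  abel

theorem Regular.exists_divides_of_same_boundary (hP : P.Regular) (ha : P.IsTip a) (hb : P.IsTip b)
    (hl : P.IsBoundary φ (a :: u ++ b :: v : List (Arm t))) :
    ∃ Q, P.Divides Q a b (a :: .inr (P.moves, 1) :: .inr (P.moves, 2) :: v)
      (b :: .inr (P.moves, 3) :: .inr (P.moves, 0) :: u) := by
  have hnodup : (a :: u ++ b :: v).Nodup := hl.nodup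
  have hmem d : d ∈ a :: u ++ b :: v ↔ P.Drawn d ∧ P.face d = φ := hl.mem_iff d
  obtain ⟨-, hφ⟩ := (hmem a).1 (by simp)
  have hne : a ≠ b := by grind
  have hu : ∀ d ∈ u, P.Drawn d ∧ d ≠ a ∧ d ≠ b := by grind
  have hv : ∀ d ∈ v, P.Drawn d ∧ d ≠ a ∧ d ≠ b := by grind
  obtain ⟨hab, hba⟩ := cycleChain_append_iff.1 hl.chain
  have hlinks := hP.links_join (c₂ := b :: .inr (P.moves, 3) :: .inr (P.moves, 0) :: u) ha hb hne
  have hcycle : P.boundaryStep.SameCycle a b :=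
    sameCycle_of_cycleChain hl.chain (by simp) (by simp)
  exact ⟨_, hP.divides_join ha hb hne hnodup (hφ ▸ hmem) (by simp) perm_append_newArms
    (hlinks.isChain_from_left hv hba) (hlinks.isChain_from_right hu hab) (by simp) (by simp)
    (absurd hcycle)⟩

theorem Regular.exists_divides_of_two_boundaries (hP : P.Regular) (ha : P.IsTip a)
    (hb : P.IsTip b) (hnodup : (a :: u ++ b :: v).Nodup)
    (hmem : ∀ d, d ∈ a :: u ++ b :: v ↔ P.Drawn d ∧ P.face d = φ)
    (hau : Cycle.Chain (P.boundaryStep · = ·) (a :: u : List (Arm t)))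
    (hbv : Cycle.Chain (P.boundaryStep · = ·) (b :: v : List (Arm t))) :
    ∃ Q, P.Divides Q a b ((a :: .inr (P.moves, 1) :: .inr (P.moves, 2) :: v) ++
      (b :: .inr (P.moves, 3) :: .inr (P.moves, 0) :: u)) [] := by
  obtain ⟨-, hφ⟩ := (hmem a).1 (by simp)
  have hne : a ≠ b := by grind
  have hu : ∀ d ∈ u, P.Drawn d ∧ d ≠ a ∧ d ≠ b := by grind
  have hv : ∀ d ∈ v, P.Drawn d ∧ d ≠ a ∧ d ≠ b := by grind
  have hlinks := hP.links_join (c₂ := []) ha hb hne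
  have hcycle : ¬ P.boundaryStep.SameCycle a b := fun h => by
    have := mem_of_sameCycle_of_cycleChain hau (by simp) h
    simp only [Cycle.mem_coe_iff] at this
    grind
  refine ⟨_, hP.divides_join ha hb hne hnodup (hφ ▸ hmem) (by simp) ?_ ?_ (by simp) (by simp)
    (absurd · hcycle) fun _ => rfl⟩
  · rw [List.append_nil]
    exact perm_append_newArms
  · exact cycleChain_append_iff.2
      ⟨hlinks.isChain_from_left hv hbv, hlinks.isChain_from_right hu hau⟩

end Curves

section TipWord

variable {n : ℕ} {t : Fin n → ℕ} {P Q : Position t} {a b d : Arm t} {φ ψ : ℕ}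
  {l l' : List (Arm t)} {x y : Vertex n} {u v w w₀ w₁ : List (Vertex n)}

/-- The vertices of the open tips among the arms of a list, in the order of the list. -/
def tipWord (P : Position t) (l : List (Arm t)) : List (Vertex n) :=
  (l.filter fun d => P.opp d = d).map vert

theorem tipWord_append : P.tipWord (l ++ l') = P.tipWord l ++ P.tipWord l' := by
  simp [tipWord]

theorem tipWord_cons_of_eq (h : P.opp d = d) : P.tipWord (d :: l) = vert d :: P.tipWord l := by
  simp [tipWord, h]

theorem tipWord_cons_of_ne (h : P.opp d ≠ d) : P.tipWord (d :: l) = P.tipWord l := by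
  simp [tipWord, h]

theorem tipWord_congr (h : ∀ d ∈ l, Q.opp d = P.opp d) : Q.tipWord l = P.tipWord l := by
  rw [tipWord, tipWord, List.filter_congr fun d hd => by rw [h d hd]]

theorem exists_of_tipWord_eq_append (h : P.tipWord l = w₀ ++ w₁) :
    ∃ l₀ l₁, l = l₀ ++ l₁ ∧ P.tipWord l₀ = w₀ ∧ P.tipWord l₁ = w₁ := by
  obtain ⟨_, _, hfilter, rfl, rfl⟩ := List.map_eq_append_iff.1 h
  obtain ⟨l₀, l₁, rfl, rfl, rfl⟩ := List.filter_eq_append_iff.1 hfilter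
  exact ⟨l₀, l₁, rfl, rfl, rfl⟩

theorem exists_of_tipWord_eq_cons (h : P.tipWord l = x :: w) :
    ∃ l₀ a l₁, l = l₀ ++ a :: l₁ ∧ P.opp a = a ∧ vert a = x ∧ P.tipWord l₀ = [] ∧
      P.tipWord l₁ = w := by
  obtain ⟨a, _, hfilter, rfl, rfl⟩ := List.map_eq_cons_iff.1 h
  obtain ⟨l₀, l₁, rfl, hl₀, ha, rfl⟩ := List.filter_eq_cons_iff.1 hfilter
  exact ⟨l₀, a, l₁, rfl, by simpa using ha, rfl, by simpa [tipWord] using hl₀, rfl⟩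

/-- The face `φ` has a single boundary component, along which the open tips are attached to the
vertices `w`, in this cyclic order. -/
def HasWord (P : Position t) (φ : ℕ) (w : List (Vertex n)) : Prop :=
  ∃ l : List (Arm t), P.IsBoundary φ l ∧ P.tipWord l = w

theorem Keeps.hasWord (h : P.Keeps Q ψ) (hw : P.HasWord ψ w) : Q.HasWord ψ w := by
  obtain ⟨l, hl, rfl⟩ := hw
  refine ⟨l, h.isBoundary hl, tipWord_congr fun d hd => ?_⟩
  exact h.opp_eq d ((hl.mem_iff d).1 hd).1 ((hl.mem_iff d).1 hd).2

theorem IsBoundary.append_comm (h : P.IsBoundary φ (l ++ l' : List (Arm t))) :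
    P.IsBoundary φ (l' ++ l : List (Arm t)) := by
  rwa [Cycle.coe_eq_coe.2 List.isRotated_append] at h

theorem HasWord.exists_tips (h : P.HasWord φ (w₀ ++ x :: (u ++ y :: v))) :
    ∃ a b l l', P.IsTip a ∧ P.IsTip b ∧ vert a = x ∧ vert b = y ∧
      P.IsBoundary φ (a :: l ++ b :: l' : List (Arm t)) ∧ P.tipWord l = u ∧
      P.tipWord l' = v ++ w₀ := by
  obtain ⟨_, hl, hword⟩ := h
  obtain ⟨l₀, _, rfl, rfl, hx⟩ := exists_of_tipWord_eq_append hword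
  obtain ⟨l₁, a, _, rfl, ha, rfl, hl₁, hu⟩ := exists_of_tipWord_eq_cons hx
  obtain ⟨l₂, _, rfl, rfl, hy⟩ := exists_of_tipWord_eq_append hu
  obtain ⟨l₃, b, l₄, rfl, hb, rfl, hl₃, rfl⟩ := exists_of_tipWord_eq_cons hy
  have hdrawn d (hd : d ∈ l₀ ++ (l₁ ++ a :: (l₂ ++ (l₃ ++ b :: l₄)))) : P.Drawn d :=
    ((hl.mem_iff d).1 hd).1
  refine ⟨a, b, l₂ ++ l₃, l₄ ++ (l₀ ++ l₁), ⟨hdrawn a (by simp), ha⟩, ⟨hdrawn b (by simp), hb⟩,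
    rfl, rfl, ?_, by simp [tipWord_append, hl₃], by simp [tipWord_append, hl₁]⟩
  have hrot := IsBoundary.append_comm (l := l₀ ++ l₁) (l' := a :: (l₂ ++ (l₃ ++ b :: l₄)))
    (by simpa using hl)
  simpa using hrot

/-- `Q` arises from `P` by a move inside the face `φ` that joins tips at `x` and `y`. -/
structure Cut (P Q : Position t) (φ : ℕ) (x y : Vertex n) : Prop where
  move : P.Move 4 Q
  regular : Q.Regular
  moves_eq : Q.moves = P.moves + 1
  graph_eq : Q.graph = addPath P.graph x (.inr P.moves) y
  keeps : ∀ ψ ≤ P.moves, ψ ≠ φ → P.Keeps Q ψ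

theorem Divides.cut {c₁ c₂ : List (Arm t)} (h : P.Divides Q a b c₁ c₂) (hP : P.Regular)
    (hne : vert a ≠ vert b) (hadj : ¬ P.graph.Adj (vert a) (vert b)) :
    P.Cut Q (P.face a) (vert a) (vert b) where
  move := ⟨⟨a, b, h.join hP⟩, (h.links.girthAtLeast_four_iff hP.girth).2 ⟨hne, hadj⟩⟩
  regular := h.regular hP hne hadj
  moves_eq := h.links.moves_eq
  graph_eq := h.links.graph_eq
  keeps := h.keeps

theorem Links.tipWord_from_left (h : P.Links Q a b) (hl : ∀ d ∈ l, P.Drawn d ∧ d ≠ a ∧ d ≠ b) :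
    Q.tipWord (a :: .inr (P.moves, 1) :: .inr (P.moves, 2) :: l) =
      .inr P.moves :: P.tipWord l := by
  rw [tipWord_cons_of_ne (h.opp_ne_iff.2 (by simp)), tipWord_cons_of_eq h.opp_one,
    tipWord_cons_of_ne (h.opp_ne_iff.2 (by simp)),
    tipWord_congr fun d hd => h.opp_of_drawn (hl d hd).1 (hl d hd).2.1 (hl d hd).2.2]
  rfl

theorem Links.tipWord_from_right (h : P.Links Q a b) (hl : ∀ d ∈ l, P.Drawn d ∧ d ≠ a ∧ d ≠ b) :
    Q.tipWord (b :: .inr (P.moves, 3) :: .inr (P.moves, 0) :: l) =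
      .inr P.moves :: P.tipWord l := by
  rw [tipWord_cons_of_ne (h.opp_ne_iff.2 (by simp)), tipWord_cons_of_eq h.opp_three,
    tipWord_cons_of_ne (h.opp_ne_iff.2 (by simp)),
    tipWord_congr fun d hd => h.opp_of_drawn (hl d hd).1 (hl d hd).2.1 (hl d hd).2.2]
  rfl

theorem Regular.exists_cut (hP : P.Regular) (hw : P.HasWord φ (w₀ ++ x :: (u ++ y :: v)))
    (hne : x ≠ y) (hadj : ¬ P.graph.Adj x y) :
    ∃ Q, P.Cut Q φ x y ∧ Q.HasWord φ (.inr P.moves :: (v ++ w₀)) ∧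
      Q.HasWord (P.moves + 1) (.inr P.moves :: u) := by
  obtain ⟨a, b, l, l', ha, hb, rfl, rfl, hboundary, rfl, hl'⟩ := hw.exists_tips
  obtain ⟨Q, hQ⟩ := hP.exists_divides_of_same_boundary ha hb hboundary
  have hnodup : (a :: l ++ b :: l').Nodup := hboundary.nodup
  have hmem d : d ∈ a :: l ++ b :: l' ↔ P.Drawn d ∧ P.face d = φ := hboundary.mem_iff d
  obtain rfl : P.face a = φ := ((hmem a).1 (by simp)).2
  refine ⟨Q, hQ.cut hP hne hadj, ⟨_, hQ.isBoundary_old, ?_⟩, ⟨_, hQ.isBoundary_new, ?_⟩⟩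
  · rw [hQ.links.tipWord_from_left (by grind), hl']
  · rw [hQ.links.tipWord_from_right (by grind)]

end TipWord

section Resolves

variable {n : ℕ} {t : Fin n → ℕ} {P Q R : Position t} {d : Arm t} {χ φ ψ g M N : ℕ}
  {G : SimpleGraph (Vertex n)} {x y : Vertex n} {u w w₀ : List (Vertex n)}

theorem IsBoundary.mem_tipWord_iff {l : List (Arm t)} (hl : P.IsBoundary φ l) :
    x ∈ P.tipWord l ↔ ∃ d, P.IsTip d ∧ P.face d = φ ∧ vert d = x := by
  have hmem d : d ∈ l ↔ P.Drawn d ∧ P.face d = φ := hl.mem_iff d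
  simp only [tipWord, List.mem_map, List.mem_filter, decide_eq_true_eq, hmem, IsTip]
  grind

theorem HasWord.mem_iff (hw : P.HasWord φ w) :
    x ∈ w ↔ ∃ d, P.IsTip d ∧ P.face d = φ ∧ vert d = x := by
  obtain ⟨l, hl, rfl⟩ := hw
  exact hl.mem_tipWord_iff

/-- `N` successive valid moves lead from one position to another. -/
inductive Reaches (g : ℕ) : Position t → Position t → ℕ → Prop
  | refl (P : Position t) : Reaches g P P 0
  | head {P Q R : Position t} {N : ℕ} (hmove : P.Move g Q) (h : Reaches g Q R N) :
      Reaches g P R (N + 1)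

theorem Reaches.trans (h : Reaches g P Q M) (h' : Reaches g Q R N) : Reaches g P R (N + M) := by
  induction h with
  | refl => exact h'
  | head hmove _ ih => exact .head hmove (ih h')

theorem Reaches.exists_seq (h : Reaches g P Q N) :
    ∃ s : ℕ → Position t, s 0 = P ∧ s N = Q ∧ ∀ i < N, (s i).Move g (s (i + 1)) := by
  induction h with
  | refl P => exact ⟨fun _ => P, rfl, rfl, by simp⟩
  | @head P _ _ _ hmove _ ih =>
    obtain ⟨s, rfl, rfl, hs⟩ := ih
    refine ⟨fun i => i.casesOn P s, rfl, rfl, fun i hi => ?_⟩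
    rcases i with _ | i
    · exact hmove
    · exact hs i (Nat.lt_of_succ_lt_succ hi)

theorem Reaches.hasPlayEndingAfter (h : Reaches g (initial t) P N) (hP : ∀ Q, ¬ P.Move g Q) :
    HasPlayEndingAfter g t N := by
  obtain ⟨s, hs0, rfl, hs⟩ := h.exists_seq
  exact ⟨s, hs0, hs, hP⟩

/-- No move of girth at least `4` is possible inside the face `φ`. -/
def SettledFace (P : Position t) (φ : ℕ) : Prop :=
  ∀ d e, P.IsTip d → P.IsTip e → P.face d = φ → P.face e = φ →
    vert d = vert e ∨ P.graph.Adj (vert d) (vert e)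

theorem HasWord.settledFace (hw : P.HasWord φ w)
    (h : ∀ x ∈ w, ∀ y ∈ w, x = y ∨ P.graph.Adj x y) : P.SettledFace φ := fun d e hd he hdφ heφ =>
  h _ (hw.mem_iff.2 ⟨d, hd, hdφ, rfl⟩) _ (hw.mem_iff.2 ⟨e, he, heφ, rfl⟩)

theorem Regular.not_move_of_settledFace (hP : P.Regular) (h : ∀ φ, P.SettledFace φ) :
    ¬ P.Move 4 Q := by
  rintro ⟨⟨a, b, hjoin⟩, hQ⟩
  obtain ⟨hne, hadj⟩ := ((hjoin.links hP.toWellFormed).girthAtLeast_four_iff hP.girth).1 hQ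
  exact (h _ a b hjoin.tip_left hjoin.tip_right rfl hjoin.same_face.symm).elim hne hadj

/-- `Q` arises from `P` by moves inside the face `φ` and the faces split off from it. -/
structure Extends (φ : ℕ) (P Q : Position t) : Prop where
  moves_le : P.moves ≤ Q.moves
  graph_le : P.graph ≤ Q.graph
  adj_of_drawn : ∀ d e, P.Drawn d → P.Drawn e → Q.graph.Adj (vert d) (vert e) →
    P.graph.Adj (vert d) (vert e)
  keeps : ∀ ψ ≤ P.moves, ψ ≠ φ → P.Keeps Q ψ

theorem Drawn.of_moves_le (hd : P.Drawn d) (h : P.moves ≤ Q.moves) : Q.Drawn d := by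
  rcases d with d | ⟨k, s⟩
  · trivial
  · exact hd.trans_le h

namespace Extends

theorem refl : Extends φ P P where
  moves_le := le_rfl
  graph_le := le_rfl
  adj_of_drawn _ _ _ _ := id
  keeps _ _ _ := ⟨fun _ => Iff.rfl, fun _ _ _ => rfl⟩

theorem trans (h : Extends φ P Q) (h' : Extends χ Q R) (hχ : χ = φ ∨ P.moves < χ) :
    Extends φ P R where
  moves_le := h.moves_le.trans h'.moves_le
  graph_le := h.graph_le.trans h'.graph_le
  adj_of_drawn d e hd he hadj := h.adj_of_drawn d e hd he <|
    h'.adj_of_drawn d e (hd.of_moves_le h.moves_le) (he.of_moves_le h.moves_le) hadj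
  keeps ψ hψ hne := (h.keeps ψ hψ hne).trans (h'.keeps ψ (hψ.trans h.moves_le) (by omega))

theorem settledFace (h : Extends φ P Q) (hψ : ψ ≤ P.moves) (hne : ψ ≠ φ)
    (hsettled : P.SettledFace ψ) : Q.SettledFace ψ := by
  have hkeeps := h.keeps ψ hψ hne
  have htip d (hd : Q.IsTip d) (hdψ : Q.face d = ψ) : P.IsTip d ∧ P.face d = ψ := by
    obtain ⟨hdP, hface⟩ := (hkeeps.mem_iff d).1 ⟨hd.1, hdψ⟩
    exact ⟨⟨hdP, (hkeeps.opp_eq d hdP hface).symm.trans hd.2⟩, hface⟩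
  intro d e hd he hdψ heψ
  obtain ⟨hdP, hdψ⟩ := htip d hd hdψ
  obtain ⟨heP, heψ⟩ := htip e he heψ
  exact (hsettled d e hdP heP hdψ heψ).imp_right fun hadj => h.graph_le hadj

end Extends

/-- The face `φ` of `P` is an instance of the game on words, with the word `w` and the graph `G`. -/
structure Realizes (P : Position t) (φ : ℕ) (G : SimpleGraph (Vertex n))
    (w : List (Vertex n)) : Prop where
  regular : P.Regular
  hasWord : P.HasWord φ w
  graph_le : G ≤ P.graph
  adj_of_mem : ∀ x ∈ w, ∀ y ∈ w, P.graph.Adj x y → G.Adj x y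

namespace Realizes

theorem ne_new (h : P.Realizes φ G w) (hx : x ∈ w) : x ≠ .inr P.moves := by
  obtain ⟨d, hd, -, rfl⟩ := h.hasWord.mem_iff.1 hx
  exact hd.1.vert_ne

theorem le_moves (h : P.Realizes φ G (w₀ ++ x :: w)) : φ ≤ P.moves := by
  obtain ⟨d, hd, rfl, -⟩ := (h.hasWord.mem_iff (x := x)).1 (by simp)
  exact h.regular.face_le d hd.1

theorem isIsolated (h : P.Realizes φ G w) : G.IsIsolated (.inr P.moves) := fun x hadj =>
  h.regular.isIsolated_of_le le_rfl x (h.graph_le hadj)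

theorem extend (h : P.Realizes φ G w) (hQ : Extends χ P Q) (hreg : Q.Regular)
    (hφ : φ ≤ P.moves) (hne : φ ≠ χ) : Q.Realizes φ G w where
  regular := hreg
  hasWord := (hQ.keeps φ hφ hne).hasWord h.hasWord
  graph_le := h.graph_le.trans hQ.graph_le
  adj_of_mem x hx y hy hadj := by
    obtain ⟨d, hd, -, rfl⟩ := h.hasWord.mem_iff.1 hx
    obtain ⟨e, he, -, rfl⟩ := h.hasWord.mem_iff.1 hy
    exact h.adj_of_mem _ hx _ hy (hQ.adj_of_drawn d e hd.1 he.1 hadj)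

theorem cut (h : P.Realizes φ G w) (hQ : P.Cut Q φ x y)
    (hψ : Q.HasWord ψ (.inr P.moves :: u)) (hu : u ⊆ w) :
    Q.Realizes ψ (addPath G x (.inr P.moves) y) (.inr P.moves :: u) where
  regular := hQ.regular
  hasWord := hψ
  graph_le := hQ.graph_eq ▸ sup_le_sup_right (sup_le_sup_right h.graph_le _) _
  adj_of_mem z hz z' hz' hadj := by
    rw [hQ.graph_eq, addPath_adj] at hadj
    refine addPath_adj.2 (hadj.imp_left fun hadj => ?_)
    have hisolated := h.regular.isIsolated_of_le le_rfl
    rcases List.mem_cons.1 hz with rfl | hz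
    · exact (hisolated _ hadj).elim
    rcases List.mem_cons.1 hz' with rfl | hz'
    · exact (hisolated _ hadj.symm).elim
    exact h.adj_of_mem z (hu hz) z' (hu hz') hadj

end Realizes

theorem Cut.extends (h : P.Cut Q φ x y) : Extends φ P Q where
  moves_le := h.moves_eq ▸ Nat.le_succ _
  graph_le := h.graph_eq ▸ le_addPath
  adj_of_drawn d e hd he hadj := by
    simpa [h.graph_eq, addPath_adj, hd.vert_ne, he.vert_ne] using hadj
  keeps := h.keeps

/-- `N` moves inside the face `φ` and the faces split off from it lead from `P` to `Q`, and in `Q`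
no move inside any of these faces is possible. -/
structure Resolves (φ N : ℕ) (P Q : Position t) : Prop where
  reaches : Reaches 4 P Q N
  regular : Q.Regular
  extend : Extends φ P Q
  settled : ∀ ψ, ψ = φ ∨ P.moves < ψ → Q.SettledFace ψ

theorem Realizes.exists_resolves (hG : WordEndsAfter G w N) (h : P.Realizes φ G w) :
    ∃ Q, Resolves φ N P Q := by
  induction hG generalizing P φ with
  | @settled G w hw =>
    refine ⟨P, .refl P, h.regular, .refl, ?_⟩
    rintro ψ (rfl | hψ)
    · exact h.hasWord.settledFace fun x hx y hy => (hw x hx y hy).imp_right (h.graph_le ·)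
    · exact fun d e hd _ hdψ _ => absurd (h.regular.face_le d hd.1) (hdψ ▸ hψ.not_ge)
  | @join G w₀ u v x y M N hne hadj _ _ ihl ihr =>
    have hnew : .inr P.moves ∉ w₀ ++ x :: (u ++ y :: v) := fun hmem => h.ne_new hmem rfl
    have hφ := h.le_moves
    have hadjP : ¬ P.graph.Adj x y := fun hxy => hadj (h.adj_of_mem x (by simp) y (by simp) hxy)
    obtain ⟨Q, hcut, hold, hface⟩ := h.regular.exists_cut h.hasWord hne hadjP
    have hQ := hcut.moves_eq
    obtain ⟨Q₁, hQ₁⟩ := ihl _ hnew h.isIsolated (h.cut hcut hface (by grind))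
    have hright := (h.cut hcut hold (by grind)).extend hQ₁.extend hQ₁.regular (by omega) (by omega)
    obtain ⟨Q₂, hQ₂⟩ := ihr _ hnew h.isIsolated hright
    refine ⟨Q₂, ?_, hQ₂.regular, ?_, fun ψ hψ => ?_⟩
    · rw [add_comm M]
      exact .head hcut.move (hQ₁.reaches.trans hQ₂.reaches)
    · exact (hcut.extends.trans hQ₁.extend (by omega)).trans hQ₂.extend (by omega)
    · by_cases hψ₁ : ψ = φ ∨ Q₁.moves < ψ
      · exact hQ₂.settled ψ hψ₁
      · exact hQ₂.extend.settledFace (by omega) (by omega) (hQ₁.settled ψ (by omega))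

end Resolves

section Initial

variable {n : ℕ} {t : Fin n → ℕ} {d : Arm t} {i j : ℕ}

theorem initial_graph : (initial t).graph = ⊥ := by
  ext v w
  simp [graph, initial, fromRel_adj]

theorem regular_initial : (initial t).Regular where
  opp_opp _ := rfl
  opp_undrawn _ _ := rfl
  girth := ⟨fun _ h => absurd rfl h, fun _ _ h => absurd rfl h, by simp [initial_graph]⟩
  face_le _ _ := le_rfl
  face_boundaryStep _ _ := rfl

/-- The tips of a spot, in rotational order. -/
def spotArms (t : Fin n → ℕ) (α : Fin n) : List (Arm t) :=
  (List.finRange (t α)).map fun s => .inl ⟨α, s⟩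

theorem cycleChain_spotArms (α : Fin n) :
    Cycle.Chain ((initial t).boundaryStep · = ·) (spotArms t α : Cycle (Arm t)) := by
  have hchain := cycleChain_finRotate_finRange (t α)
  rw [spotArms, ← Cycle.map_coe, Cycle.chain_map]
  refine hchain.imp fun s s' h => ?_
  rw [← h]
  rfl

theorem nodup_spotArms (α : Fin n) : (spotArms t α).Nodup :=
  (List.nodup_finRange _).map fun s s' h => by simpa using h

theorem mem_spotArms {α : Fin n} : d ∈ spotArms t α ↔ ∃ s, d = .inl ⟨α, s⟩ := by
  simp [spotArms, eq_comm]

theorem exists_spotArms_eq_cons {α : Fin n} (h : t α = i + 1) :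
    ∃ a l, spotArms t α = a :: l ∧ vert a = .inl α ∧
      (initial t).tipWord l = List.replicate i (.inl α) := by
  have hlength : (spotArms t α).length = i + 1 := by simp [spotArms, h]
  obtain ⟨a, l, hl⟩ := List.exists_cons_of_length_eq_add_one hlength
  have hvert d (hd : d ∈ spotArms t α) : vert d = .inl α := by
    obtain ⟨s, rfl⟩ := mem_spotArms.1 hd
    rfl
  refine ⟨a, l, hl, hvert a (by simp [hl]), List.eq_replicate_iff.2 ⟨?_, fun x hx => ?_⟩⟩
  · rw [hl, List.length_cons, Nat.add_right_cancel_iff] at hlength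
    simpa [tipWord, initial] using hlength
  · obtain ⟨d, hd, rfl⟩ := List.mem_map.1 hx
    exact hvert d (by simp [hl, List.mem_of_mem_filter hd])

theorem mem_spotArms_append_iff {t : Fin 2 → ℕ} {d : Arm t} {α β : Fin 2} (hne : α ≠ β) :
    d ∈ spotArms t α ++ spotArms t β ↔ (initial t).Drawn d ∧ (initial t).face d = 0 := by
  rcases d with ⟨γ, s⟩ | ⟨k, s⟩
  · have hγ : γ = α ∨ γ = β := by omega
    rcases hγ with rfl | rfl <;> simp [mem_spotArms, Drawn, initial]
  · simp [mem_spotArms, Drawn, initial]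

theorem exists_first_move {t : Fin 2 → ℕ} {α β : Fin 2} (hne : α ≠ β) (hα : t α = i + 1)
    (hβ : t β = j + 1) :
    ∃ Q, (initial t).Cut Q 0 (.inl α) (.inl β) ∧ Q.HasWord 0 (mainWord α β 0 0 i j) ∧
      Q.HasWord 1 [] := by
  obtain ⟨a, u, hau, ha, hu⟩ := exists_spotArms_eq_cons hα
  obtain ⟨b, v, hbv, hb, hv⟩ := exists_spotArms_eq_cons hβ
  have hnodup : (a :: u ++ b :: v).Nodup := by
    rw [← hau, ← hbv]
    refine (nodup_spotArms α).append (nodup_spotArms β) fun d hd hd' => ?_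
    obtain ⟨s, rfl⟩ := mem_spotArms.1 hd
    simp [mem_spotArms, hne] at hd'
  have hmem d : d ∈ a :: u ++ b :: v ↔ (initial t).Drawn d ∧ (initial t).face d = 0 := by
    rw [← hau, ← hbv, mem_spotArms_append_iff hne]
  have hdrawn d (hd : d ∈ a :: u ++ b :: v) : (initial t).Drawn d := ((hmem d).1 hd).1
  obtain ⟨Q, hQ⟩ := regular_initial.exists_divides_of_two_boundaries
    ⟨hdrawn a (by simp), rfl⟩ ⟨hdrawn b (by simp), rfl⟩ hnodup hmem
    (hau ▸ cycleChain_spotArms α) (hbv ▸ cycleChain_spotArms β)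
  have hcut := hQ.cut regular_initial (by simpa [ha, hb] using hne) (by simp [initial_graph])
  rw [ha, hb] at hcut
  refine ⟨Q, hcut, ⟨_, hQ.isBoundary_old, ?_⟩, ⟨_, hQ.isBoundary_new, rfl⟩⟩
  rw [tipWord_append, hQ.links.tipWord_from_left (by grind),
    hQ.links.tipWord_from_right (by grind), hu, hv]
  rfl

end Initial

end Position

open Position

variable {t : Fin 2 → ℕ} {α β : Fin 2} {i j N : ℕ}

theorem hasPlayEndingAfter_succ_of_wordEndsAfter (hne : α ≠ β) (hα : t α = i + 1)
    (hβ : t β = j + 1)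
    (hG : WordEndsAfter (addPath ⊥ (.inl α) (.inr 0) (.inl β)) (mainWord α β 0 0 i j) N) :
    HasPlayEndingAfter 4 t (N + 1) := by
  obtain ⟨P, hcut, hword, hnil⟩ := exists_first_move hne hα hβ
  have hgraph := hcut.graph_eq
  rw [initial_graph] at hgraph
  have hrealizes : P.Realizes 0 (addPath ⊥ (.inl α) (.inr 0) (.inl β)) (mainWord α β 0 0 i j) :=
    ⟨hcut.regular, hword, hgraph.ge, fun _ _ _ _ hadj => hgraph.le hadj⟩
  obtain ⟨Q, hQ⟩ := hrealizes.exists_resolves hG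
  have hmoves : P.moves = 1 := hcut.moves_eq
  have hsettled φ : Q.SettledFace φ := by
    by_cases hφ : φ = 1
    · subst hφ
      exact hQ.extend.settledFace hmoves.ge one_ne_zero (hnil.settledFace (by simp))
    · exact hQ.settled φ (by omega)
  exact Reaches.hasPlayEndingAfter (.head hcut.move hQ.reaches) fun _ =>
    hQ.regular.not_move_of_settledFace hsettled

theorem hasPlayEndingAfter_add (hne : α ≠ β) (hα : 2 ≤ t α) (hαβ : t α ≤ t β)
    (hβα : t β ≤ 2 * t α) : HasPlayEndingAfter 4 t (t α + t β) := by
  obtain ⟨i, hi⟩ : ∃ i, t α = i + 1 := ⟨t α - 1, by omega⟩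
  obtain ⟨j, hj⟩ : ∃ j, t β = j + 1 := ⟨t β - 1, by omega⟩
  have hlen : t α + t β = i + j + 1 + 1 := by omega
  rw [hlen]
  exact hasPlayEndingAfter_succ_of_wordEndsAfter hne hi hj <|
    .mainWord_longest hne (not_addPath_adj_of_ne (by simp) (by simp) (by simp)) (by omega) (by simp)
      (by omega) (by omega)

theorem hasPlayEndingAfter_six (hne : α ≠ β) (hα : 3 ≤ t α) (hβ : 3 ≤ t β) :
    HasPlayEndingAfter 4 t 6 := by
  obtain ⟨i, hi⟩ : ∃ i, t α = i + 2 + 1 := ⟨t α - 3, by omega⟩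
  obtain ⟨j, hj⟩ : ∃ j, t β = j + 2 + 1 := ⟨t β - 3, by omega⟩
  exact hasPlayEndingAfter_succ_of_wordEndsAfter hne hi hj <|
    .mainWord_five hne (not_addPath_adj_of_ne (by simp) (by simp) (by simp))

end BrusselsSprout

open BrusselsSprout in
theorem mainTheorem11_general (p q : ℕ) :
    (2 ≤ p → 2 ≤ q → p ≤ 2 * q → q ≤ 2 * p → HasPlayEndingAfter 4 ![p, q] (p + q)) ∧
      (3 ≤ p → 3 ≤ q → HasPlayEndingAfter 4 ![p, q] 6) := by
  refine ⟨fun hp hq hpq hqp => ?_, hasPlayEndingAfter_six (t := ![p, q]) zero_ne_one⟩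
  rcases le_total p q with hle | hle
  · exact hasPlayEndingAfter_add (t := ![p, q]) zero_ne_one hp hle hqp
  · rw [add_comm]
    exact hasPlayEndingAfter_add (t := ![p, q]) one_ne_zero hq hle hpq

theorem mainTheorem11 (p q : ℕ) (hp : 3 ≤ p) (hpq : p ≤ q) (hq : q ≤ 2 * p) :
    BrusselsSprout.HasPlayEndingAfter 4 ![p, q] (p + q) ∧
      BrusselsSprout.HasPlayEndingAfter 4 ![p, q] 6 := by
  obtain ⟨hadd, hsix⟩ := mainTheorem11_general p q
  exact ⟨hadd (by omega) (by omega) (by omega) hq, hsix hp (by omega)⟩
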